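/- Let $0\le N\le M$ be integers and let $K$ be a field. For $\mathbf z=(z_1,\dots,z_N)\in K^N$ with pairwise distinct entries, $\beta\in K$, and a Young diagram $\lambda=(\lambda_1\ge\dots\ge\lambda_N\ge 0)$, define the Schur, Grothendieck and dual Grothendieck polynomials by $$s_\lambda(\mathbf z)=\frac{\det_{1\le j,k\le N}\big(z_j^{\lambda_k+N-k}\big)}{\prod_{1\le j<k\le N}(z_j-z_k)},\qquad G_\lambda(\mathbf z;\beta)=\frac{\det_{1\le j,k\le N}\big(z_j^{\lambda_k+N-k}(1+\beta z_j)^{k-1}\big)}{\prod_{1\le j<k\le N}(z_j-z_k)},$$ $$\overline G_\lambda(\mathbf z;\beta)=\frac{\det_{1\le j,k\le N}\big(z_j^{\lambda_k+N-k}(1+\beta z_j^{-1})^{1-k}\big)}{\prod_{1\le j<k\le N}(z_j-z_k)},$$ where in the last formula $z_j\ne 0$ and $1+\beta z_j^{-1}\neq 0$ for all $j$. Write $\lambda\subseteq (M-N)^N$ if $M-N\ge\lambda_1\ge\dots\ge\lambda_N\ge 0$. Let $\mathbf z=(z_1,\dots,z_N)$ and $\mathbf y=(y_1,\dots,y_N)$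 be in $K^N$, with the $z_j$ pairwise distinct, the $y_j$ pairwise distinct, and $z_jy_k\ne 1$ for all $j,k$. Then: 1. For every $\beta\in K$, if $y_k\neq 0$ and $1+\beta y_k^{-1}\ne 0$ for all $k$, then $$\sum_{\lambda\subseteq(M-N)^N}G_\lambda(\mathbf z;\beta)\,\overline G_\lambda(\mathbf y;\beta)=\prod_{1\le j<k\le N}\frac{1}{(z_j-z_k)(y_j-y_k)}\;\det_{1\le j,k\le N}\left[\frac{(z_jy_k)^M-\left(\dfrac{1+\beta z_j}{1+\beta y_k^{-1}}\right)^{N-1}}{z_jy_k-1}\right].$$ 2. At $\beta=0$ this becomes the Cauchy identity for Schur polynomials: $G_\lambda(\mathbf z;0)=s_\lambda(\mathbf z)$ for every $\lambda$, likewise $\overline G_\lambda(\mathbf y;0)=s_\lambda(\mathbf y)$ (at $\beta=0$ the factors $(1+\beta y_j^{-1})^{1-k}$ are read as $1$, also where $y_j=0$), and $$\sum_{\lambda\subseteq(M-N)^N}s_\lambda(\mathbf z)\,s_\lambda(\mathbf y)=\prod_{1\le j<k\le N}\frac{1}{(z_j-z_k)(y_j-y_k)}\;\det_{1\le j,k\le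 N}\left[\frac{(z_jy_k)^M-1}{z_jy_k-1}\right].$$ In particular, for $K$ a field of rational functions in which $\beta$, the $z_j$ and the $y_j$ are independent indeterminates, these are identities of rational functions. -/

import Mathlib

namespace GrothendieckCauchy

/-- The product `∏_{j < k} (z_j - z_k)`. -/
def vdm {K : Type*} [Field K] {N : ℕ} (z : Fin N → K) : K :=
  ∏ j : Fin N, ∏ k ∈ Finset.Ioi j, (z j - z k)

/-- The Schur polynomial
`s_l(z) = det (z_j ^ (l_k + N - k)) / ∏_{j < k} (z_j - z_k)`, `1 ≤ j, k ≤ N`.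
Indices in `Fin N` start at `0`, so that `k` below stands for `k - 1` in this formula. -/
def schur {K : Type*} [Field K] {N : ℕ} (l : Fin N → ℕ) (z : Fin N → K) : K :=
  (Matrix.of fun j k : Fin N => z j ^ (l k + (N - 1 - (k : ℕ)))).det / vdm z

/-- The Grothendieck polynomial
`G_l(z; β) = det (z_j ^ (l_k + N - k) (1 + β z_j) ^ (k - 1)) / ∏_{j < k} (z_j - z_k)`,
with the same shift of the index `k`. -/
def groth {K : Type*} [Field K] {N : ℕ} (l : Fin N → ℕ) (z : Fin N → K) (β : K) : K :=
  (Matrix.of fun j k : Fin N =>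
    z j ^ (l k + (N - 1 - (k : ℕ))) * (1 + β * z j) ^ (k : ℕ)).det / vdm z

/-- The dual Grothendieck polynomial
`det (z_j ^ (l_k + N - k) (1 + β z_j⁻¹) ^ (1 - k)) / ∏_{j < k} (z_j - z_k)`,
with the same shift of the index `k`; the power `1 - k` is an integer power. -/
def dualGroth {K : Type*} [Field K] {N : ℕ} (l : Fin N → ℕ) (z : Fin N → K) (β : K) : K :=
  (Matrix.of fun j k : Fin N =>
    z j ^ (l k + (N - 1 - (k : ℕ))) * (1 + β * (z j)⁻¹) ^ (-((k : ℕ) : ℤ))).det / vdm z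

/-- The Young diagrams `l ⊆ L ^ N`: sequences `L ≥ l_1 ≥ ⋯ ≥ l_N ≥ 0` of integers. -/
def boxPartitions (L N : ℕ) : Finset (Fin N → ℕ) :=
  (Fintype.piFinset fun _ : Fin N => Finset.range (L + 1)).filter fun l => Antitone l

end GrothendieckCauchy

/-!
Adding the staircase to a Young diagram turns the left side into a sum, over strictly decreasing
sequences `m > l_1 > ⋯ > l_n ≥ 0`, of `det (z_j ^ l_k u_j ^ (k - 1)) det (y_j ^ l_k w_j ^ (k - 1))`
with `u = 1 + β z` and `w = (1 + β y⁻¹)⁻¹`. The claim is that this sum is the determinant with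
entries `((z_j y_k) ^ m - (u_j w_k) ^ (n - 1)) / (z_j y_k - 1)`. Cauchy–Binet does not apply, because
the factors depend on the position `k` in the sequence and not only on `l_k`. What makes the claim
true is the relation `u_j w_k - 1 = (z_j y_k - 1) (1 - w_k)`.

The proof is by induction on `n` and on `m ≥ n - 1`. When `m = n - 1` there are no sequences, and the
relation makes the entries a sum of `n - 1` products of a function of `j` and a function of `k`,
so that the determinant vanishes (`det_cauchyMatrix_eq_zero`). Passing from `m` to `m + 1` adds the
sequences with `l_1 = m`. Expanding both determinants along their first columns and applying the
identity for `n - 1` gives a sum over minors, which is the change of the determinant of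
`(u_j w_k ((z_j y_k) ^ m - (u_j w_k) ^ (n - 2)) / (z_j y_k - 1))` when the matrix
`((z_j y_k) ^ m)` of rank one is added (`det_add_vecMulVec_sub_det`). On the other side, the entries
of the determinant for `m + 1` exceed those for `m` by the same matrix of rank one
(`cauchyMatrix_succ`). The two matrices to which it is added differ, again by the relation, by
another matrix of rank one with the same column vector `(z_j ^ m)` (`mul_cauchyMatrix`), and this
has no effect on the change of the determinant (`det_add_vecMulVec_add_vecMulVec`).

The Schur case is `u = w = 1`, which satisfies the relation for every `y`, also where `y_j = 0`.
-/

namespace GrothendieckCauchy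

open Matrix Finset

/-! ### Determinants -/

/-- The effect on a determinant of adding a rank one matrix, expanded in the minors of the
original matrix, which need not be invertible. -/
theorem det_add_vecMulVec_sub_det {R : Type*} [CommRing R] {n : ℕ}
    (A : Matrix (Fin (n + 1)) (Fin (n + 1)) R) (p q : Fin (n + 1) → R) :
    (A + vecMulVec p q).det - A.det =
      ∑ i : Fin (n + 1), ∑ j : Fin (n + 1), (-1) ^ (i : ℕ) * p i * ((-1) ^ (j : ℕ) * q j) *
        (A.submatrix i.succAbove j.succAbove).det := by
  -- Both sides compute the determinant of `A` bordered by the row `-q`, the column `p` and a `1`.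
  let B : Matrix (Fin (n + 2)) (Fin (n + 2)) R :=
    of (Fin.cons (Fin.cons 1 fun j => -q j) fun i => Fin.cons (p i) (A i))
  let C : Matrix (Fin (n + 2)) (Fin (n + 2)) R :=
    of (Fin.cons (Fin.cons 1 fun j => -q j)
      fun i => Fin.cons 0 ((A + vecMulVec p q) i))
  have hBC : B.det = C.det := by
    refine det_eq_of_forall_row_eq_smul_add_const (Fin.cons 0 p) 0 rfl fun i j => ?_
    refine Fin.cases ?_ (fun i => ?_) i <;> refine Fin.cases ?_ (fun j => ?_) j <;>
      simp [B, C, vecMulVec_apply]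
  have hC : C.det = (A + vecMulVec p q).det := by
    rw [det_succ_column_zero, Fin.sum_univ_succ]
    simp only [Fin.val_zero, pow_zero, Fin.succAbove_zero, one_mul]
    rw [sum_eq_zero fun i _ => by simp [C], add_zero]
    simp only [C, of_apply, Fin.cons_zero, one_mul]
    rfl
  have hB : B.det = A.det + ∑ i : Fin (n + 1), ∑ j : Fin (n + 1),
      (-1) ^ (i : ℕ) * p i * ((-1) ^ (j : ℕ) * q j) * (A.submatrix i.succAbove j.succAbove).det := by
    rw [det_succ_column_zero, Fin.sum_univ_succ]
    congr 1
    · simp only [Fin.val_zero, pow_zero, Fin.succAbove_zero, one_mul, B, of_apply, Fin.cons_zero]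
      rfl
    · refine sum_congr rfl fun i _ => ?_
      rw [det_succ_row_zero, mul_sum]
      refine sum_congr rfl fun j _ => ?_
      have hm : ((B.submatrix i.succ.succAbove Fin.succ).submatrix Fin.succ j.succAbove) =
          A.submatrix i.succAbove j.succAbove := by
        ext a b
        simp [B]
      rw [hm]
      simp only [B, of_apply, Fin.cons_zero, Fin.cons_succ, submatrix_apply, Fin.val_succ,
        Fin.succ_succAbove_zero]
      ring
  rw [← hC, ← hBC, hB, add_sub_cancel_left]

/-- Adding a second rank one matrix with the same column vector does not change the effect of
adding the first one. -/
theorem det_add_vecMulVec_add_vecMulVec {R : Type*} [CommRing R] {n : ℕ}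
    (A : Matrix (Fin (n + 1)) (Fin (n + 1)) R) (p q r : Fin (n + 1) → R) :
    (A + vecMulVec p r + vecMulVec p q).det - (A + vecMulVec p r).det =
      (A + vecMulVec p q).det - A.det := by
  have h : (A + vecMulVec p r + vecMulVec p q).det - A.det =
      ((A + vecMulVec p r).det - A.det) + ((A + vecMulVec p q).det - A.det) := by
    rw [add_assoc, ← vecMulVec_add]
    simp only [det_add_vecMulVec_sub_det, ← sum_add_distrib]
    exact sum_congr rfl fun i _ => sum_congr rfl fun j _ => by simp only [Pi.add_apply]; ring
  linear_combination h

theorem det_mul_eq_zero_of_card_lt {K m n : Type*} [Field K] [Fintype m] [DecidableEq m]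
    [Fintype n] (A : Matrix m n K) (B : Matrix n m K) (h : Fintype.card n < Fintype.card m) :
    (A * B).det = 0 := by
  by_contra hdet
  have hrank := rank_of_isUnit (A * B)
    ((isUnit_iff_isUnit_det _).2 (isUnit_iff_ne_zero.2 hdet))
  exact absurd ((rank_mul_le_left A B).trans (rank_le_card_width A)) (by omega)

/-! ### Strictly decreasing exponent sequences -/

/-- The sequences `m > l_1 > ⋯ > l_n ≥ 0` of integers. -/
def strictSeqs (m n : ℕ) : Finset (Fin n → ℕ) :=
  (Fintype.piFinset fun _ : Fin n => range m).filter fun l => StrictAnti l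

theorem mem_strictSeqs {m n : ℕ} {l : Fin n → ℕ} :
    l ∈ strictSeqs m n ↔ (∀ i, l i < m) ∧ StrictAnti l := by
  simp [strictSeqs]

/-- Subtracting the staircase from a strictly decreasing sequence leaves a decreasing one. -/
theorem add_le_of_strictAnti {n : ℕ} {l : Fin (n + 1) → ℕ} (hl : StrictAnti l)
    {i j : Fin (n + 1)} (hij : i ≤ j) : l j + (j : ℕ) ≤ l i + (i : ℕ) := by
  refine Fin.antitone_iff_succ_le (f := fun i => l i + (i : ℕ)) |>.2 (fun k => ?_) hij
  have := hl (Fin.castSucc_lt_succ (i := k))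
  simp only [Fin.val_succ, Fin.val_castSucc]
  omega

theorem strictSeqs_self_succ (n : ℕ) : strictSeqs n (n + 1) = ∅ := by
  refine eq_empty_of_forall_notMem fun l hl => ?_
  rw [mem_strictSeqs] at hl
  have h := add_le_of_strictAnti hl.2 (Fin.zero_le (Fin.last n))
  have := hl.1 0
  simp only [Fin.val_last, Fin.val_zero] at h
  omega

/-- Sorting the sequences below `m + 1` by whether the largest entry equals `m`. -/
theorem sum_strictSeqs_succ {R : Type*} [AddCommMonoid R] (m n : ℕ) (f : (Fin (n + 1) → ℕ) → R) :
    ∑ l ∈ strictSeqs (m + 1) (n + 1), f l =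
      ∑ l ∈ strictSeqs m (n + 1), f l + ∑ l ∈ strictSeqs m n, f (Fin.cons m l) := by
  have hcons : Function.Injective fun l : Fin n → ℕ => (Fin.cons m l : Fin (n + 1) → ℕ) :=
    Fin.cons_right_injective (α := fun _ => ℕ) m
  rw [← sum_image (s := strictSeqs m n) (f := f) hcons.injOn, ← sum_union]
  · refine sum_congr (Finset.ext fun l => ?_) fun _ _ => rfl
    simp only [mem_union, mem_image, mem_strictSeqs]
    constructor
    · rintro ⟨hlt, hl⟩
      rcases (Nat.lt_succ_iff.1 (hlt 0)).lt_or_eq with h0 | h0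
      · exact Or.inl ⟨fun i => (hl.antitone (Fin.zero_le i)).trans_lt h0, hl⟩
      · refine Or.inr ⟨Fin.tail l, ⟨fun i => h0 ▸ hl (Fin.succ_pos i),
          fun i j hij => hl (Fin.succ_lt_succ_iff.2 hij)⟩, ?_⟩
        rw [← h0, Fin.cons_self_tail]
    · rintro (⟨hlt, hl⟩ | ⟨l, ⟨hlt, hl⟩, rfl⟩)
      · exact ⟨fun i => (hlt i).trans m.lt_succ_self, hl⟩
      · refine ⟨fun i => ?_, fun i j => ?_⟩
        · refine Fin.cases (by simp) (fun i => ?_) i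
          simpa using (hlt i).trans m.lt_succ_self
        · refine Fin.cases ?_ (fun i => ?_) i <;> refine Fin.cases ?_ (fun j => ?_) j
          · simp
          · simpa using hlt j
          · simp
          · simpa using fun hij => hl hij
  · rw [disjoint_left]
    rintro _ hl hl'
    obtain ⟨l, -, rfl⟩ := mem_image.1 hl'
    simpa using (mem_strictSeqs.1 hl).1 0

/-- Young diagrams in the box `(m - n) ^ n` correspond to strictly decreasing sequences below `m`,
by adding the staircase `(n - 1, …, 1, 0)`. -/
theorem sum_boxPartitions {R : Type*} [AddCommMonoid R] {m n : ℕ} (hnm : n ≤ m)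
    (f : (Fin n → ℕ) → R) :
    ∑ l ∈ boxPartitions (m - n) n, f (fun k => l k + (n - 1 - (k : ℕ))) =
      ∑ l ∈ strictSeqs m n, f l := by
  obtain _ | n := n
  · refine sum_congr (Finset.ext fun l => ?_) fun l _ => congrArg f (Subsingleton.elim _ _)
    simp [boxPartitions, strictSeqs, Subsingleton.antitone, Subsingleton.strictAnti]
  refine sum_bij' (fun l _ k => l k + (n + 1 - 1 - (k : ℕ)))
    (fun l _ k => l k - (n + 1 - 1 - (k : ℕ))) ?_ ?_ ?_ ?_ fun _ _ => rfl
  · intro l hl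
    simp only [boxPartitions, mem_filter, Fintype.mem_piFinset, mem_range] at hl
    refine mem_strictSeqs.2 ⟨fun i => ?_, fun i j hij => ?_⟩
    · have := hl.1 i
      omega
    · have := hl.2 hij.le
      have := Fin.lt_def.1 hij
      have := j.is_lt
      dsimp only
      omega
  · intro l hl
    rw [mem_strictSeqs] at hl
    simp only [boxPartitions, mem_filter, Fintype.mem_piFinset, mem_range]
    refine ⟨fun i => ?_, fun i j hij => ?_⟩
    · have h := add_le_of_strictAnti hl.2 (Fin.zero_le i)
      have := hl.1 0
      have := i.is_lt
      simp only [Fin.val_zero] at h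
      omega
    · have := add_le_of_strictAnti hl.2 hij
      have := j.is_lt
      have := Fin.le_def.1 hij
      dsimp only
      omega
  · intro l _
    simp
  · intro l hl
    funext i
    have h := add_le_of_strictAnti (mem_strictSeqs.1 hl).2 (Fin.le_last i)
    have := i.is_lt
    simp only [Fin.val_last] at h
    dsimp only
    omega

/-! ### The sum of products of determinants -/

/-- The matrix `(z_j ^ l_k u_j ^ (k - 1))`, `1 ≤ j, k ≤ n`, whose determinant is the numerator of
a Grothendieck polynomial. The index `k` is counted from `0`. -/
def altMatrix {K : Type*} [Field K] {n : ℕ} (z u : Fin n → K) (l : Fin n → ℕ) :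
    Matrix (Fin n) (Fin n) K :=
  of fun j k => z j ^ l k * u j ^ (k : ℕ)

/-- The matrix with entries `((z_j y_k) ^ m - (u_j w_k) ^ e) / (z_j y_k - 1)`. -/
def cauchyMatrix {K : Type*} [Field K] {n : ℕ} (z u y w : Fin n → K) (m e : ℕ) :
    Matrix (Fin n) (Fin n) K :=
  of fun j k => ((z j * y k) ^ m - (u j * w k) ^ e) / (z j * y k - 1)

section

variable {K : Type*} [Field K] {n : ℕ}

theorem det_altMatrix_cons (z u : Fin (n + 1) → K) (m : ℕ) (l : Fin n → ℕ) :
    (altMatrix z u (Fin.cons m l)).det =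
      ∑ i : Fin (n + 1), (-1) ^ (i : ℕ) * z i ^ m * ((∏ a, u (i.succAbove a)) *
        (altMatrix (z ∘ i.succAbove) (u ∘ i.succAbove) l).det) := by
  rw [det_succ_column_zero]
  refine sum_congr rfl fun i _ => ?_
  rw [← det_mul_column]
  congr 1
  · simp [altMatrix]
  · congr 1
    ext a b
    simp only [altMatrix, submatrix_apply, of_apply, Fin.cons_succ, Function.comp_apply,
      Fin.val_succ]
    ring

/-- The case without sequences: the matrix of size `n + 1` factors through dimension `n`. The
hypothesis `huw` is the relation between `u` and `w` in another form. -/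
theorem det_cauchyMatrix_eq_zero (z u y w : Fin (n + 1) → K)
    (hzy : ∀ j k, z j * y k ≠ 1)
    (huw : ∀ j k, z j * y k - u j * w k = (z j * y k - 1) * w k) :
    (cauchyMatrix z u y w n n).det = 0 := by
  have h : cauchyMatrix z u y w n n =
      (of fun j (i : Fin n) => z j ^ (i : ℕ) * u j ^ (n - 1 - (i : ℕ))) *
        (of fun (i : Fin n) k => w k * (y k ^ (i : ℕ) * w k ^ (n - 1 - (i : ℕ)))) := by
    ext j k
    have hne := sub_ne_zero.2 (hzy j k)
    have hgeom := (Commute.all (z j * y k) (u j * w k)).geom_sum₂_mul n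
    rw [huw, sum_range] at hgeom
    simp only [cauchyMatrix, of_apply, mul_apply]
    rw [← hgeom, mul_left_comm, mul_div_cancel_left₀ _ hne, sum_mul]
    exact sum_congr rfl fun i _ => by rw [mul_pow, mul_pow]; ring
  rw [h]
  exact det_mul_eq_zero_of_card_lt _ _ (by simp)

/-- The entries of the two matrices at `m + 1` and at `m` differ by `(z_j y_k) ^ m`. -/
theorem cauchyMatrix_succ (z u y w : Fin n → K) (hzy : ∀ j k, z j * y k ≠ 1) (m e : ℕ) :
    cauchyMatrix z u y w (m + 1) e =
      cauchyMatrix z u y w m e + vecMulVec (fun j => z j ^ m) (fun k => y k ^ m) := by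
  ext j k
  have := sub_ne_zero.2 (hzy j k)
  simp only [cauchyMatrix, of_apply, Matrix.add_apply, vecMulVec_apply]
  field_simp
  ring

/-- Scaling the entries by `u_j w_k` raises the exponent `e` by one, up to a matrix of rank one
whose column vector `(z_j ^ m)` is that of `cauchyMatrix_succ`. -/
theorem mul_cauchyMatrix (z u y w : Fin n → K) (hzy : ∀ j k, z j * y k ≠ 1)
    (c : Fin n → K) (huw : ∀ j k, u j * w k - 1 = (z j * y k - 1) * c k) (m e : ℕ) :
    of (fun j k => u j * w k * cauchyMatrix z u y w m e j k) =
      cauchyMatrix z u y w m (e + 1) +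
        vecMulVec (fun j => z j ^ m) (fun k => y k ^ m * c k) := by
  ext j k
  have := sub_ne_zero.2 (hzy j k)
  simp only [cauchyMatrix, of_apply, Matrix.add_apply, vecMulVec_apply]
  field_simp
  linear_combination (z j ^ m * y k ^ m) * huw j k

theorem submatrix_mul_cauchyMatrix (z u y w : Fin (n + 1) → K) (m : ℕ) (i j : Fin (n + 1)) :
    ((of fun a b => u a * w b * cauchyMatrix z u y w m (n - 1) a b).submatrix
        i.succAbove j.succAbove).det =
      (∏ a, u (i.succAbove a)) * (∏ b, w (j.succAbove b)) *
        (cauchyMatrix (z ∘ i.succAbove) (u ∘ i.succAbove) (y ∘ j.succAbove) (w ∘ j.succAbove)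
          m (n - 1)).det := by
  rw [mul_assoc, ← det_mul_row, ← det_mul_column]
  congr 1
  ext a b
  simp [cauchyMatrix, mul_assoc]

end

/-- The Cauchy identity before division by the Vandermonde products, by induction on `n` and on
`m`. The condition relating `u` and `w` is all that is used of `u = 1 + β z` and
`w = (1 + β y⁻¹)⁻¹`; it also allows `u = w = 1`, for any `y`. -/
theorem sum_det_altMatrix_mul_det_altMatrix {K : Type*} [Field K] {n m : ℕ} (hnm : n ≤ m + 1)
    (z u y w : Fin n → K) (hzy : ∀ j k, z j * y k ≠ 1)
    (huw : ∀ j k, u j * w k - 1 = (z j * y k - 1) * (1 - w k)) :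
    ∑ l ∈ strictSeqs m n, (altMatrix z u l).det * (altMatrix y w l).det =
      (cauchyMatrix z u y w m (n - 1)).det := by
  induction n generalizing m with
  | zero =>
    have h : strictSeqs m 0 = {Fin.elim0} := by
      ext l
      simp [mem_strictSeqs, Subsingleton.strictAnti, Subsingleton.elim l Fin.elim0]
    simp [h]
  | succ n ih =>
    rw [Nat.add_sub_cancel]
    replace hnm := Nat.le_of_succ_le_succ hnm
    induction m, hnm using Nat.le_induction with
    | base =>
      rw [strictSeqs_self_succ, sum_empty, det_cauchyMatrix_eq_zero z u y w hzy]
      exact fun j k => by linear_combination -huw j k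
    | succ m hnm ihm =>
      -- The sequences with largest entry `m` account for the change of the right side.
      have hstep : ∑ l ∈ strictSeqs m n, (altMatrix z u (Fin.cons m l)).det *
          (altMatrix y w (Fin.cons m l)).det =
          (cauchyMatrix z u y w (m + 1) n).det - (cauchyMatrix z u y w m n).det := by
        rw [cauchyMatrix_succ z u y w hzy, ← det_add_vecMulVec_add_vecMulVec _ _ _
          (fun k => y k ^ m * (1 - w k)), det_add_vecMulVec_sub_det]
        simp only [det_altMatrix_cons, sum_mul_sum]
        rw [sum_comm]
        refine sum_congr rfl fun i _ => ?_
        rw [sum_comm]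
        refine sum_congr rfl fun j _ => ?_
        have hminor : ((cauchyMatrix z u y w m n + vecMulVec (fun j => z j ^ m)
            (fun k => y k ^ m * (1 - w k))).submatrix i.succAbove j.succAbove).det =
            (∏ a, u (i.succAbove a)) * (∏ b, w (j.succAbove b)) *
            (cauchyMatrix (z ∘ i.succAbove) (u ∘ i.succAbove) (y ∘ j.succAbove)
              (w ∘ j.succAbove) m (n - 1)).det := by
          rw [← submatrix_mul_cauchyMatrix]
          -- For `n = 0` the truncated exponent `n - 1` is harmless: the minors are empty.
          obtain _ | n := n
          · simp
          · rw [mul_cauchyMatrix z u y w hzy _ huw, Nat.add_sub_cancel]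
        rw [hminor, ← ih (hnm.trans m.le_succ) (z ∘ i.succAbove) (u ∘ i.succAbove)
          (y ∘ j.succAbove) (w ∘ j.succAbove) (fun _ _ => hzy _ _)
          (fun _ _ => huw _ _), mul_sum, mul_sum]
        exact sum_congr rfl fun l _ => by ring
      rw [sum_strictSeqs_succ, ihm, hstep, add_sub_cancel]

theorem prod_one_div_eq_inv_vdm_mul_inv_vdm {K : Type*} [Field K] {n : ℕ} (z y : Fin n → K) :
    ∏ j : Fin n, ∏ k ∈ Ioi j, 1 / ((z j - z k) * (y j - y k)) = (vdm z)⁻¹ * (vdm y)⁻¹ := by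
  simp only [vdm, one_div, mul_inv, prod_mul_distrib, prod_inv_distrib]

theorem groth_zero {K : Type*} [Field K] {n : ℕ} (l : Fin n → ℕ) (z : Fin n → K) :
    groth l z 0 = schur l z := by
  simp [groth, schur]

theorem dualGroth_zero {K : Type*} [Field K] {n : ℕ} (l : Fin n → ℕ) (y : Fin n → K) :
    dualGroth l y 0 = schur l y := by
  simp [dualGroth, schur]

theorem groth_eq_det_altMatrix_div {K : Type*} [Field K] {n : ℕ} (l : Fin n → ℕ) (z : Fin n → K)
    (β : K) :
    groth l z β =
      (altMatrix z (fun j => 1 + β * z j) fun k => l k + (n - 1 - (k : ℕ))).det / vdm z := rfl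

theorem dualGroth_eq_det_altMatrix_div {K : Type*} [Field K] {n : ℕ} (l : Fin n → ℕ)
    (y : Fin n → K) (β : K) :
    dualGroth l y β = (altMatrix y (fun j => (1 + β * (y j)⁻¹)⁻¹)
      fun k => l k + (n - 1 - (k : ℕ))).det / vdm y := by
  simp [dualGroth, altMatrix]

/-- The sum over Young diagrams for `u` and `w` as in `sum_det_altMatrix_mul_det_altMatrix`. -/
theorem sum_boxPartitions_det_altMatrix {K : Type*} [Field K] {n m : ℕ} (hnm : n ≤ m)
    (z u y w : Fin n → K) (hzy : ∀ j k, z j * y k ≠ 1)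
    (huw : ∀ j k, u j * w k - 1 = (z j * y k - 1) * (1 - w k)) :
    ∑ l ∈ boxPartitions (m - n) n,
        (altMatrix z u fun k => l k + (n - 1 - (k : ℕ))).det / vdm z *
          ((altMatrix y w fun k => l k + (n - 1 - (k : ℕ))).det / vdm y) =
      (∏ j : Fin n, ∏ k ∈ Ioi j, 1 / ((z j - z k) * (y j - y k))) *
        (cauchyMatrix z u y w m (n - 1)).det := by
  rw [sum_boxPartitions hnm
      (fun l => (altMatrix z u l).det / vdm z * ((altMatrix y w l).det / vdm y)),
    ← sum_det_altMatrix_mul_det_altMatrix (hnm.trans m.le_succ) z u y w hzy huw,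
    prod_one_div_eq_inv_vdm_mul_inv_vdm, mul_sum]
  exact sum_congr rfl fun l _ => by rw [div_eq_mul_inv, div_eq_mul_inv]; ring

end GrothendieckCauchy

theorem mainTheorem1 {K : Type*} [Field K] {M N : ℕ} (hNM : N ≤ M)
    (z y : Fin N → K) (hz : Function.Injective z) (hy : Function.Injective y)
    (hzy : ∀ j k, z j * y k ≠ 1) :
    -- the Cauchy identity for Grothendieck polynomials
    (∀ β : K, (∀ k, y k ≠ 0) → (∀ k, 1 + β * (y k)⁻¹ ≠ 0) →
      ∑ l ∈ GrothendieckCauchy.boxPartitions (M - N) N,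
          GrothendieckCauchy.groth l z β * GrothendieckCauchy.dualGroth l y β =
        (∏ j : Fin N, ∏ k ∈ Finset.Ioi j, 1 / ((z j - z k) * (y j - y k))) *
          (Matrix.of fun j k : Fin N =>
            ((z j * y k) ^ M - ((1 + β * z j) / (1 + β * (y k)⁻¹)) ^ (N - 1)) /
              (z j * y k - 1)).det) ∧
    -- its two sides at `β = 0` are those of the Cauchy identity for Schur polynomials
    (∀ l : Fin N → ℕ, Antitone l →
      GrothendieckCauchy.groth l z 0 = GrothendieckCauchy.schur l z ∧
      GrothendieckCauchy.dualGroth l y 0 = GrothendieckCauchy.schur l y) ∧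
    ∑ l ∈ GrothendieckCauchy.boxPartitions (M - N) N,
        GrothendieckCauchy.schur l z * GrothendieckCauchy.schur l y =
      (∏ j : Fin N, ∏ k ∈ Finset.Ioi j, 1 / ((z j - z k) * (y j - y k))) *
        (Matrix.of fun j k : Fin N =>
          ((z j * y k) ^ M - 1) / (z j * y k - 1)).det := by
  open GrothendieckCauchy in
  refine ⟨fun β hy0 hv => ?_, fun l _ => ⟨groth_zero l z, dualGroth_zero l y⟩, ?_⟩
  · simp only [groth_eq_det_altMatrix_div, dualGroth_eq_det_altMatrix_div]
    rw [sum_boxPartitions_det_altMatrix hNM z _ y _ hzy fun j k => ?_]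
    · simp only [cauchyMatrix, div_eq_mul_inv]
    -- The relation `u_j w_k - 1 = (z_j y_k - 1) (1 - w_k)`, cleared of denominators.
    have h0 := hy0 k
    have h1 : y k + β ≠ 0 := by
      have h := mul_ne_zero h0 (hv k)
      rwa [mul_add, mul_one, mul_left_comm, mul_inv_cancel₀ h0, mul_one] at h
    have hw : (1 + β * (y k)⁻¹)⁻¹ = y k / (y k + β) := by
      rw [← inv_div, add_div, div_self h0, div_eq_mul_inv]
    rw [hw]
    field_simp
    ring
  · simp only [← groth_zero _ z, ← dualGroth_zero _ y]
    simp only [groth_eq_det_altMatrix_div, dualGroth_eq_det_altMatrix_div]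
    rw [sum_boxPartitions_det_altMatrix hNM z _ y _ hzy fun j k => by simp]
    simp [cauchyMatrix]
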